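/- Let $(X,Y)$ be a bivariate normal random vector with zero mean vector, variances $(\sigma_X^2,\sigma_Y^2)$ with $\sigma_X,\sigma_Y>0$, and correlation coefficient $\rho=0$. Let $n\ge 1$, let $Z_1,\dots,Z_n$ be independent random variables each with the distribution of $Z=XY$, and put $\overline{Z}_n=n^{-1}(Z_1+\cdots+Z_n)$ and $s_n=\sigma_X\sigma_Y/n$. Then for every $x\in\mathbb{R}$ the cumulative distribution function $F(x)=\mathbb{P}(\overline{Z}_n\le x)$ is $$F(x)=\frac12+\frac{x}{2s_n}\left[K_{\frac{n-1}{2}}\!\left(\frac{|x|}{s_n}\right)\mathbf{L}_{\frac{n-3}{2}}\!\left(\frac{|x|}{s_n}\right)+\mathbf{L}_{\frac{n-1}{2}}\!\left(\frac{|x|}{s_n}\right)K_{\frac{n-3}{2}}\!\left(\frac{|x|}{s_n}\right)\right],$$ where for $x=0$ the second term on the right is read as $0$ (so $F(0)=1/2$). Here, for $\nu\in\mathbb{R}$ and $y>0$, $K_\nu(y)=\int_0^\infty e^{-y\cosh t}\cosh(\nu t)\,dt$ is the modified Bessel function of the second kind and $\mathbf{L}_\nu(y)=\sum_{j=0}^\infty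 \frac{(y/2)^{\nu+2j+1}}{\Gamma(j+3/2)\,\Gamma(j+\nu+3/2)}$ is the modified Struve function of the first kind, with the convention that $1/\Gamma$ is $0$ at the poles of $\Gamma$. -/

import Mathlib

open MeasureTheory ProbabilityTheory

noncomputable section

/-- The modified Bessel function of the second kind,
`K_ν(x) = ∫_0^∞ exp (-x cosh t) cosh (ν t) dt`, for `ν` real and `x > 0`. -/
def besselK (ν x : ℝ) : ℝ :=
  ∫ t in Set.Ioi (0 : ℝ), Real.exp (-x * Real.cosh t) * Real.cosh (ν * t)

/-- The modified Struve function (of the first kind),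
`L_ν(x) = ∑_{j ≥ 0} (x/2)^(ν+2j+1) / (Γ(j+3/2) Γ(j+ν+3/2))`, for `ν` real and `x > 0`.
Where `Γ` has a pole, `Real.Gamma` is `0`, and so the term is `0`, which is the usual
convention `1/Γ = 0`. -/
def struveL (ν x : ℝ) : ℝ :=
  ∑' j : ℕ, (x / 2) ^ (ν + 2 * (j : ℝ) + 1) /
    (Real.Gamma ((j : ℝ) + 3 / 2) * Real.Gamma ((j : ℝ) + ν + 3 / 2))

/-- Under `P`, the pair `(X, Y)` is a bivariate normal random vector with zero mean vector,
variances `(σX ^ 2, σY ^ 2)` and correlation coefficient `ρ` (for `σX, σY > 0`). -/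
structure IsCenteredBivariateNormal {Ω : Type*} [MeasurableSpace Ω] (P : Measure Ω)
    (X Y : Ω → ℝ) (σX σY ρ : ℝ) : Prop where
  gaussian : HasGaussianLaw (fun ω => (X ω, Y ω)) P
  mean_fst : ∫ ω, X ω ∂P = 0
  mean_snd : ∫ ω, Y ω ∂P = 0
  variance_fst : variance X P = σX ^ 2
  variance_snd : variance Y P = σY ^ 2
  correlation : covariance X Y P / (σX * σY) = ρ

/-- The mean `n⁻¹ (Z_1 + ⋯ + Z_n)`. -/
def sampleMean {Ω : Type*} {n : ℕ} (Z : Fin n → Ω → ℝ) (ω : Ω) : ℝ :=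
  (n : ℝ)⁻¹ * ∑ i, Z i ω

end

/-!
The product of two independent centred normal variables, conditionally on the first one, is normal
with a random variance, so its characteristic function is `(1 + (t σX σY) ^ 2) ^ (-1 / 2)`, and
that of the mean of `n` copies divided by `s` is `(1 + t ^ 2) ^ (-n / 2)`
(`charFun_map_mul_of_isCenteredBivariateNormal`). This is also the characteristic function of
`√W N`, for `N` standard normal and `W` independent of `N` with the Gamma law of shape `n / 2` and
rate `1 / 2`, so the two laws agree (`map_sampleMean_eq_gaussianGammaMixture`). By Tonelli's
theorem the law of `√W N` has at `u > 0` a density proportional to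
`∫ w ^ (ν - 1) exp (-(w + u ^ 2 / w) / 2) dw` with `ν = (n - 1) / 2`, and the substitution
`w = u exp t` identifies this integral with `2 u ^ ν K_ν(u)`
(`lintegral_gammaPDF_mul_gaussianPDF`, `besselInt_eq_besselK`).

It remains to integrate `u ^ ν K_ν(u)` over `(0, x]`; symmetry then gives the distribution function
on the whole line. The antiderivative is `x (K_ν L_{ν-1} + L_ν K_{ν-1})` up to a constant. Written
as `x ^ ν K_ν · x ^ (1-ν) L_{ν-1} + x ^ ν L_ν · x ^ (1-ν) K_{ν-1}`, it is differentiated by the rules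
`(x ^ ν K_ν)' = -x ^ ν K_{ν-1}`, `(x ^ ν L_ν)' = x ^ ν L_{ν-1}`, and
`(x ^ (-ν) L_ν)' = x ^ (-ν) L_{ν+1} + const`: all products of a `K` and an `L` cancel, and only the
constant times `x ^ ν K_ν` survives (`hasDerivAt_besselStruve`). The antiderivative tends to `0`
at `0` (`tendsto_besselStruve_zero`): the factors with `K` may be singular there, but
`x ^ (1-ν) L_{ν-1}` and `x ^ ν L_ν` vanish faster than these grow.

The derivative rules for `K` come from differentiating the integral over `w` under the integral
sign, together with `K_{-ν} = K_ν`; those for `L` come from contiguity relations of the entire series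
`∑ z ^ j / (Γ(j + a) Γ(j + b))`.
-/

section
open Filter Topology Set
open scoped NNReal ENNReal

/-! ### The modified Struve function -/

/-- The entire function `z ↦ ∑ z ^ j / (Γ(j + a) Γ(j + b))`. The modified Struve function `L_ν` is
`(x / 2) ^ (ν + 1)` times its value at `(x / 2) ^ 2` with `a = 3 / 2` and `b = ν + 3 / 2`. -/
noncomputable def invGammaSeries (a b z : ℝ) : ℝ :=
  ∑' j : ℕ, z ^ j / (Real.Gamma (j + a) * Real.Gamma (j + b))

lemma gamma_natCast_add_pos {a : ℝ} (ha : 0 < a) (j : ℕ) : 0 < Real.Gamma (j + a) :=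
  Real.Gamma_pos_of_pos (by positivity)

lemma summable_invGammaSeries {a b : ℝ} (ha : 0 < a) (hb : 0 < b) (z : ℝ) :
    Summable fun j : ℕ => z ^ j / (Real.Gamma (j + a) * Real.Gamma (j + b)) := by
  rcases eq_or_ne z 0 with rfl | hz
  · refine summable_of_ne_finset_zero (s := {0}) fun j hj => ?_
    simp [zero_pow (by simpa using hj : j ≠ 0)]
  refine summable_of_ratio_test_tendsto_lt_one (l := 0) one_pos (Eventually.of_forall fun j => ?_) ?_
  · have := gamma_natCast_add_pos ha j
    have := gamma_natCast_add_pos hb j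
    positivity
  have h : ∀ j : ℕ, ‖z ^ (j + 1) / (Real.Gamma ((j + 1 : ℕ) + a) * Real.Gamma ((j + 1 : ℕ) + b))‖ /
      ‖z ^ j / (Real.Gamma (j + a) * Real.Gamma (j + b))‖ = |z| * ((j + a)⁻¹ * (j + b)⁻¹) := by
    intro j
    have h1 := gamma_natCast_add_pos ha j
    have h2 := gamma_natCast_add_pos hb j
    have h3 : (0 : ℝ) < j + a := by positivity
    have h4 : (0 : ℝ) < j + b := by positivity
    have e1 : Real.Gamma ((j + 1 : ℕ) + a) = (j + a) * Real.Gamma (j + a) := by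
      rw [← Real.Gamma_add_one h3.ne']; push_cast; ring_nf
    have e2 : Real.Gamma ((j + 1 : ℕ) + b) = (j + b) * Real.Gamma (j + b) := by
      rw [← Real.Gamma_add_one h4.ne']; push_cast; ring_nf
    rw [e1, e2, Real.norm_eq_abs, Real.norm_eq_abs, abs_div, abs_div, abs_pow, abs_pow,
      abs_of_pos (by positivity : 0 < Real.Gamma (j + a) * Real.Gamma (j + b)),
      abs_of_pos (by positivity :
        0 < (j + a) * Real.Gamma (j + a) * ((j + b) * Real.Gamma (j + b)))]
    have := abs_pos.2 hz
    field_simp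
    rw [pow_succ]
  simp_rw [h]
  have hlim : ∀ c : ℝ, Tendsto (fun j : ℕ => ((j : ℝ) + c)⁻¹) atTop (𝓝 0) := fun c =>
    (tendsto_natCast_atTop_atTop.atTop_add tendsto_const_nhds).inv_tendsto_atTop
  simpa using ((hlim a).mul (hlim b)).const_mul |z|

lemma invGammaSeries_comm (a b z : ℝ) : invGammaSeries a b z = invGammaSeries b a z := by
  simp only [invGammaSeries, mul_comm]

lemma hasDerivAt_invGammaSeries_tsum {a b : ℝ} (ha : 0 < a) (hb : 0 < b) (z : ℝ) :
    Summable (fun j : ℕ => j * z ^ (j - 1) / (Real.Gamma (j + a) * Real.Gamma (j + b))) ∧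
    HasDerivAt (invGammaSeries a b)
      (∑' j : ℕ, j * z ^ (j - 1) / (Real.Gamma (j + a) * Real.Gamma (j + b))) z := by
  set r : ℝ := |z| + 1
  have hr : 1 ≤ r := by simp [r]
  have hz : z ∈ Ioo (-r) r := by
    rw [mem_Ioo, ← abs_lt]; simp [r]
  have hu := summable_invGammaSeries ha hb (2 * r)
  have hbound : ∀ (j : ℕ) (y : ℝ), y ∈ Ioo (-r) r →
      ‖j * y ^ (j - 1) / (Real.Gamma (j + a) * Real.Gamma (j + b))‖ ≤
        (2 * r) ^ j / (Real.Gamma (j + a) * Real.Gamma (j + b)) := by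
    intro j y hy
    have h1 := gamma_natCast_add_pos ha j
    have h2 := gamma_natCast_add_pos hb j
    rw [Real.norm_eq_abs, abs_div, abs_of_pos (mul_pos h1 h2)]
    gcongr
    rw [abs_mul, abs_pow, mul_pow, Nat.abs_cast]
    gcongr
    · exact_mod_cast Nat.lt_two_pow_self.le
    · calc |y| ^ (j - 1) ≤ r ^ (j - 1) := by gcongr; exact (abs_lt.2 hy).le
        _ ≤ r ^ j := pow_le_pow_right₀ hr (Nat.sub_le _ _)
  refine ⟨.of_norm_bounded hu fun j => hbound j z hz, ?_⟩
  exact hasDerivAt_tsum_of_isPreconnected hu isOpen_Ioo isPreconnected_Ioo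
    (fun j y _ => (hasDerivAt_pow j y).div_const _) hbound hz (summable_invGammaSeries ha hb z) hz

/-- The contiguity relation `z h' + (b - 1) h = h(b - 1)`, for `h` the series with parameters
`a` and `b`; it comes from `(j + b - 1) / Γ(j + b) = 1 / Γ(j + b - 1)`. -/
lemma mul_deriv_invGammaSeries_add {a b : ℝ} (ha : 0 < a) (hb : 0 < b) (z : ℝ) :
    z * deriv (invGammaSeries a (b + 1)) z + b * invGammaSeries a (b + 1) z =
      invGammaSeries a b z := by
  obtain ⟨hs, hd⟩ := hasDerivAt_invGammaSeries_tsum ha (by positivity : 0 < b + 1) z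
  rw [hd.deriv, invGammaSeries, invGammaSeries, ← tsum_mul_left, ← tsum_mul_left,
    ← (hs.mul_left z).tsum_add ((summable_invGammaSeries ha (by positivity) z).mul_left b)]
  refine tsum_congr fun j => ?_
  have h1 := gamma_natCast_add_pos ha j
  have h2 := gamma_natCast_add_pos hb j
  have h4 : (0 : ℝ) < j + b := by positivity
  rw [← add_assoc, Real.Gamma_add_one h4.ne']
  have : z * (j * z ^ (j - 1)) = j * z ^ j := by
    cases j with
    | zero => simp
    | succ k => simp [pow_succ]; ring
  field_simp
  linear_combination this

lemma invGammaSeries_eq_add {a b : ℝ} (ha : 0 < a) (hb : 0 < b) (z : ℝ) :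
    invGammaSeries a b z =
      1 / (Real.Gamma a * Real.Gamma b) + z * invGammaSeries (a + 1) (b + 1) z := by
  rw [invGammaSeries, (summable_invGammaSeries ha hb z).tsum_eq_zero_add, invGammaSeries,
    ← tsum_mul_left]
  congr 1
  · simp
  refine tsum_congr fun j => ?_
  rw [pow_succ, mul_comm (z ^ j), mul_div_assoc]
  push_cast
  rw [add_right_comm, add_assoc _ a 1, add_right_comm, add_assoc _ b 1]

lemma differentiableAt_invGammaSeries {a b : ℝ} (ha : 0 < a) (hb : 0 < b) (z : ℝ) :
    DifferentiableAt ℝ (invGammaSeries a b) z :=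
  (hasDerivAt_invGammaSeries_tsum ha hb z).2.differentiableAt

lemma struveL_eq_invGammaSeries (ν : ℝ) {x : ℝ} (hx : 0 < x) :
    struveL ν x =
      (x / 2) ^ (ν + 1) * invGammaSeries (3 / 2) (ν + 3 / 2) ((x / 2) ^ 2) := by
  rw [struveL, invGammaSeries, ← tsum_mul_left]
  refine tsum_congr fun j => ?_
  have : (x / 2) ^ (ν + 2 * (j : ℝ) + 1) = (x / 2) ^ (ν + 1) * ((x / 2) ^ 2) ^ j := by
    rw [add_right_comm, Real.rpow_add (by positivity), ← pow_mul]
    congr 1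
    exact_mod_cast Real.rpow_natCast (x / 2) (2 * j)
  rw [this, mul_div_assoc, add_assoc]

lemma rpow_mul_struveL (ν : ℝ) {x : ℝ} (hx : 0 < x) :
    x ^ ν * struveL ν x =
      2 ^ ν * ((x / 2) ^ (2 * ν + 1) * invGammaSeries (3 / 2) (ν + 3 / 2) ((x / 2) ^ 2)) := by
  have h2 : x ^ ν = 2 ^ ν * (x / 2) ^ ν := by
    rw [← Real.mul_rpow (by norm_num) (by positivity)]; congr 1; ring
  rw [struveL_eq_invGammaSeries ν hx, h2, two_mul, add_assoc,
    Real.rpow_add (by positivity : 0 < x / 2) ν (ν + 1)]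
  ring

lemma rpow_neg_mul_struveL (ν : ℝ) {x : ℝ} (hx : 0 < x) :
    x ^ (-ν) * struveL ν x =
      2 ^ (-ν) * ((x / 2) * invGammaSeries (3 / 2) (ν + 3 / 2) ((x / 2) ^ 2)) := by
  have h2 : x ^ (-ν) = 2 ^ (-ν) * (x / 2) ^ (-ν) := by
    rw [← Real.mul_rpow (by norm_num) (by positivity)]; congr 1; ring
  have h3 : (x / 2) ^ (-ν) * (x / 2) ^ (ν + 1) = x / 2 := by
    rw [← Real.rpow_add (by positivity)]; simp
  rw [struveL_eq_invGammaSeries ν hx, h2, ← mul_assoc, mul_assoc (2 ^ (-ν)), h3, mul_assoc]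

lemma hasDerivAt_invGammaSeries_sq {a b : ℝ} (ha : 0 < a) (hb : 0 < b) (x : ℝ) :
    HasDerivAt (fun y => invGammaSeries a b ((y / 2) ^ 2))
      (deriv (invGammaSeries a b) ((x / 2) ^ 2) * (x / 2)) x := by
  have h1 : HasDerivAt (fun y : ℝ => (y / 2) ^ 2) (x / 2) x := by
    refine (((hasDerivAt_id' x).div_const 2).pow 2).congr_deriv ?_
    norm_num
    ring
  exact (differentiableAt_invGammaSeries ha hb _).hasDerivAt.comp x h1

lemma hasDerivAt_rpow_mul_struveL {ν x : ℝ} (hν : -(1 / 2) < ν) (hx : 0 < x) :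
    HasDerivAt (fun y => y ^ ν * struveL ν y) (x ^ ν * struveL (ν - 1) x) x := by
  have hev : (fun y => y ^ ν * struveL ν y) =ᶠ[𝓝 x] fun y =>
      2 ^ ν * ((y / 2) ^ (2 * ν + 1) * invGammaSeries (3 / 2) (ν + 3 / 2) ((y / 2) ^ 2)) := by
    filter_upwards [lt_mem_nhds hx] with y hy using rpow_mul_struveL ν hy
  refine HasDerivAt.congr_of_eventuallyEq ?_ hev
  have hp : HasDerivAt (fun y : ℝ => (y / 2) ^ (2 * ν + 1))
      (1 / 2 * (2 * ν + 1) * (x / 2) ^ (2 * ν + 1 - 1)) x :=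
    ((hasDerivAt_id x).div_const 2).rpow_const (Or.inl (by simp [hx.ne']))
  have hS := hasDerivAt_invGammaSeries_sq (a := 3 / 2) (b := ν + 3 / 2) (by norm_num)
    (by linarith) x
  refine ((hp.mul hS).const_mul (2 ^ ν)).congr_deriv (Eq.symm ?_)
  have hc := mul_deriv_invGammaSeries_add (a := 3 / 2) (b := ν + 1 / 2) (by norm_num)
    (by linarith) ((x / 2) ^ 2)
  rw [show ν + 1 / 2 + 1 = ν + 3 / 2 by ring] at hc
  have h2 : x ^ ν = 2 ^ ν * (x / 2) ^ ν := by
    rw [← Real.mul_rpow (by norm_num) (by positivity)]; congr 1; ring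
  rw [struveL_eq_invGammaSeries _ hx, h2, show ν - 1 + 3 / 2 = ν + 1 / 2 by ring, ← hc]
  have e1 : (x / 2) ^ (2 * ν + 1) = (x / 2) ^ ν * (x / 2) ^ ν * (x / 2) := by
    rw [Real.rpow_add_one (by positivity), two_mul, Real.rpow_add (by positivity)]
  have e2 : (x / 2) ^ (2 * ν + 1 - 1) = (x / 2) ^ ν * (x / 2) ^ ν := by
    rw [add_sub_cancel_right, two_mul, Real.rpow_add (by positivity)]
  rw [e1, e2, sub_add_cancel]
  ring

/-- The constant on the right is what makes `L_ν` solve an inhomogeneous Bessel equation. -/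
lemma hasDerivAt_rpow_neg_mul_struveL {ν x : ℝ} (hν : -(3 / 2) < ν) (hx : 0 < x) :
    HasDerivAt (fun y => y ^ (-ν) * struveL ν y)
      (x ^ (-ν) * struveL (ν + 1) x + 2 ^ (-ν) / (√Real.pi * Real.Gamma (ν + 3 / 2))) x := by
  have hev : (fun y => y ^ (-ν) * struveL ν y) =ᶠ[𝓝 x] fun y =>
      2 ^ (-ν) * ((y / 2) * invGammaSeries (3 / 2) (ν + 3 / 2) ((y / 2) ^ 2)) := by
    filter_upwards [lt_mem_nhds hx] with y hy using rpow_neg_mul_struveL ν hy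
  refine HasDerivAt.congr_of_eventuallyEq ?_ hev
  have hS := hasDerivAt_invGammaSeries_sq (a := 3 / 2) (b := ν + 3 / 2) (by norm_num)
    (by linarith) x
  refine ((((hasDerivAt_id' x).div_const 2).mul hS).const_mul (2 ^ (-ν))).congr_deriv (Eq.symm ?_)
  have hc := mul_deriv_invGammaSeries_add (a := ν + 3 / 2) (b := 1 / 2) (by linarith)
    (by norm_num) ((x / 2) ^ 2)
  have hz := invGammaSeries_eq_add (a := 1 / 2) (b := ν + 3 / 2) (by norm_num) (by linarith)
    ((x / 2) ^ 2)
  rw [show (1 / 2 + 1 : ℝ) = 3 / 2 by norm_num] at hz hc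
  rw [invGammaSeries_comm _ (1 / 2), hz, Real.Gamma_one_half_eq] at hc
  have hcomm : invGammaSeries (ν + 3 / 2) (3 / 2) = invGammaSeries (3 / 2) (ν + 3 / 2) :=
    funext fun _ => invGammaSeries_comm _ _ _
  rw [hcomm] at hc
  have h2 : x ^ (-ν) = 2 ^ (-ν) * (x / 2) ^ (-ν) := by
    rw [← Real.mul_rpow (by norm_num) (by positivity)]; congr 1; ring
  have h3 : (x / 2) ^ (-ν) * (x / 2) ^ (ν + 1 + 1) = (x / 2) ^ 2 := by
    rw [← Real.rpow_add (by positivity), ← Real.rpow_two]; congr 1; ring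
  rw [struveL_eq_invGammaSeries _ hx, h2, show ν + 1 + 3 / 2 = ν + 3 / 2 + 1 by ring]
  linear_combination 2 ^ (-ν) * invGammaSeries (3 / 2) (ν + 3 / 2 + 1) ((x / 2) ^ 2) * h3
    - 2 ^ (-ν) * hc

/-! ### The modified Bessel function of the second kind -/

/-- The integral `∫_0^∞ w ^ (p - 1) exp (-(w + u ^ 2 / w) / 2) dw`, which is `2 u ^ p K_p(u)`. -/
noncomputable def besselInt (p u : ℝ) : ℝ :=
  ∫ w in Ioi (0 : ℝ), w ^ (p - 1) * Real.exp (-(w + u ^ 2 / w) / 2)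

lemma exp_neg_le_rpow {q y : ℝ} (hq : 0 ≤ q) (hy : 0 < y) :
    Real.exp (-y) ≤ q ^ q * y ^ (-q) := by
  rcases hq.eq_or_lt with rfl | hq
  · simpa using hy.le
  rw [Real.rpow_neg hy.le, Real.exp_neg, ← div_eq_mul_inv, inv_eq_one_div,
    div_le_div_iff₀ (Real.exp_pos _) (by positivity), one_mul]
  calc y ^ q = (q * (y / q)) ^ q := by rw [mul_div_cancel₀ _ hq.ne']
    _ = q ^ q * (y / q) ^ q := Real.mul_rpow hq.le (by positivity)
    _ ≤ q ^ q * (Real.exp (y / q)) ^ q := by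
        gcongr
        linarith [Real.add_one_le_exp (y / q)]
    _ = q ^ q * Real.exp y := by rw [← Real.exp_mul, div_mul_cancel₀ _ hq.ne']

lemma integrableOn_rpow_mul_exp_neg_half {p : ℝ} (hp : 0 < p) :
    IntegrableOn (fun w : ℝ => w ^ (p - 1) * Real.exp (-w / 2)) (Ioi 0) := by
  have h := integrableOn_rpow_mul_exp_neg_mul_rpow (p := 1) (s := p - 1) (b := 1 / 2)
    (by linarith) one_pos (by norm_num)
  refine h.congr_fun (fun w _ => ?_) measurableSet_Ioi
  simp only [Real.rpow_one]
  congr 2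
  ring

/-- Trading the factor `exp (-u ^ 2 / (2 w))` for a power of `w / u ^ 2` makes the integrand of
`besselInt` integrable at `0` whatever `p` is. -/
lemma besselInt_integrand_le {p q u w : ℝ} (hq : 0 ≤ q) (hu : 0 < u) (hw : 0 < w) :
    w ^ (p - 1) * Real.exp (-(w + u ^ 2 / w) / 2) ≤
      (2 * q) ^ q * u ^ (-2 * q) * (w ^ (p + q - 1) * Real.exp (-w / 2)) := by
  have h := exp_neg_le_rpow hq (by positivity : 0 < u ^ 2 / (2 * w))
  have e1 : Real.exp (-(w + u ^ 2 / w) / 2) =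
      Real.exp (-w / 2) * Real.exp (-(u ^ 2 / (2 * w))) := by
    rw [← Real.exp_add]; congr 1; field_simp; ring
  have e2 : (u ^ 2 / (2 * w)) ^ (-q) = 2 ^ q * u ^ (-2 * q) * w ^ q := by
    rw [Real.div_rpow (by positivity) (by positivity), Real.mul_rpow (by norm_num) hw.le,
      ← Real.rpow_natCast, ← Real.rpow_mul hu.le, Real.rpow_neg hw.le, Real.rpow_neg zero_le_two]
    push_cast
    field_simp
  have e3 : w ^ (p + q - 1) = w ^ (p - 1) * w ^ q := by
    rw [← Real.rpow_add hw]; congr 1; ring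
  rw [e2] at h
  rw [e1, e3, Real.mul_rpow zero_le_two hq]
  calc _ = (w ^ (p - 1) * Real.exp (-w / 2)) * Real.exp (-(u ^ 2 / (2 * w))) := by ring
    _ ≤ (w ^ (p - 1) * Real.exp (-w / 2)) * (q ^ q * (2 ^ q * u ^ (-2 * q) * w ^ q)) := by gcongr
    _ = _ := by ring

lemma measurable_besselInt_integrand (p u : ℝ) :
    Measurable fun w : ℝ => w ^ (p - 1) * Real.exp (-(w + u ^ 2 / w) / 2) := by
  fun_prop

lemma integrableOn_besselInt (p : ℝ) {u : ℝ} (hu : 0 < u) :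
    IntegrableOn (fun w => w ^ (p - 1) * Real.exp (-(w + u ^ 2 / w) / 2)) (Ioi 0) := by
  have hq : 0 ≤ |p| + 1 := by positivity
  have hpq : 0 < p + (|p| + 1) := by linarith [neg_abs_le p]
  refine Integrable.mono' ((integrableOn_rpow_mul_exp_neg_half hpq).const_mul
    ((2 * (|p| + 1)) ^ (|p| + 1) * u ^ (-2 * (|p| + 1))))
    (measurable_besselInt_integrand p u).aestronglyMeasurable ?_
  filter_upwards [ae_restrict_mem measurableSet_Ioi] with w hw
  rw [mem_Ioi] at hw
  rw [Real.norm_of_nonneg (by positivity)]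
  exact besselInt_integrand_le hq hu hw

lemma besselInt_nonneg (p u : ℝ) : 0 ≤ besselInt p u :=
  setIntegral_nonneg measurableSet_Ioi fun w (hw : 0 < w) => by positivity

/-- The growth of `besselInt p` at `0`. -/
lemma exists_besselInt_le {p q : ℝ} (hq : 0 ≤ q) (hpq : 0 < p + q) :
    ∃ C, ∀ u, 0 < u → besselInt p u ≤ C * u ^ (-2 * q) := by
  refine ⟨(2 * q) ^ q * ∫ w in Ioi (0 : ℝ), w ^ (p + q - 1) * Real.exp (-w / 2), fun u hu => ?_⟩
  rw [mul_right_comm, ← integral_const_mul]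
  exact setIntegral_mono_on (integrableOn_besselInt p hu)
    ((integrableOn_rpow_mul_exp_neg_half hpq).const_mul _) measurableSet_Ioi
    fun w hw => besselInt_integrand_le hq hu hw

lemma hasDerivAt_besselInt (p : ℝ) {u : ℝ} (hu : 0 < u) :
    HasDerivAt (besselInt p) (-u * besselInt (p - 1) u) u := by
  have key := hasDerivAt_integral_of_dominated_loc_of_deriv_le
    (μ := volume.restrict (Ioi (0 : ℝ))) (x₀ := u) (s := Ioo (u / 2) (2 * u))
    (F := fun u w => w ^ (p - 1) * Real.exp (-(w + u ^ 2 / w) / 2))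
    (F' := fun u w => -u * (w ^ (p - 1 - 1) * Real.exp (-(w + u ^ 2 / w) / 2)))
    (bound := fun w => 2 * u * (w ^ (p - 1 - 1) * Real.exp (-(w + (u / 2) ^ 2 / w) / 2)))
    (Ioo_mem_nhds (by linarith) (by linarith))
    (Eventually.of_forall fun v => (measurable_besselInt_integrand p v).aestronglyMeasurable)
    (integrableOn_besselInt p hu)
    ((measurable_besselInt_integrand (p - 1) u).const_mul _).aestronglyMeasurable ?_
    ((integrableOn_besselInt (p - 1) (half_pos hu)).const_mul _) ?_
  · refine key.2.congr_deriv ?_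
    rw [integral_const_mul, besselInt]
  · filter_upwards [ae_restrict_mem measurableSet_Ioi] with w hw v hv
    rw [mem_Ioi] at hw
    have hv0 : 0 < v := by linarith [hv.1]
    rw [norm_mul, norm_neg, Real.norm_of_nonneg hv0.le, Real.norm_of_nonneg (by positivity)]
    gcongr
    · exact hv.2.le
    · exact hv.1.le
  · filter_upwards [ae_restrict_mem measurableSet_Ioi] with w hw v hv
    rw [mem_Ioi] at hw
    have h1 : HasDerivAt (fun v : ℝ => -(w + v ^ 2 / w) / 2) (-v / w) v := by
      refine (((((hasDerivAt_id' v).pow 2).div_const w).const_add w).neg.div_const 2).congr_deriv ?_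
      field_simp
      ring
    refine (h1.exp.const_mul (w ^ (p - 1))).congr_deriv ?_
    rw [Real.rpow_sub_one hw.ne' (p - 1)]
    field_simp

/-- The substitution `w = u exp t`. -/
lemma besselInt_eq_besselK (p : ℝ) {u : ℝ} (hu : 0 < u) :
    besselInt p u = 2 * u ^ p * besselK p u := by
  have himg : (fun t => u * Real.exp t) '' univ = Ioi 0 := by
    rw [image_univ]
    ext w
    refine ⟨?_, fun hw => ⟨Real.log (w / u), ?_⟩⟩
    · rintro ⟨t, rfl⟩
      exact mul_pos hu (Real.exp_pos t)
    · simp only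
      rw [Real.exp_log (div_pos hw hu), mul_div_cancel₀ _ hu.ne']
  have hinj : InjOn (fun t => u * Real.exp t) univ := fun s _ t _ h =>
    Real.exp_injective (mul_left_cancel₀ hu.ne' h)
  have hder : ∀ t ∈ univ, HasDerivWithinAt (fun t => u * Real.exp t) (u * Real.exp t) univ t :=
    fun t _ => ((Real.hasDerivAt_exp t).const_mul u).hasDerivWithinAt
  have hfun : ∀ t : ℝ, |u * Real.exp t| • ((u * Real.exp t) ^ (p - 1) *
      Real.exp (-(u * Real.exp t + u ^ 2 / (u * Real.exp t)) / 2)) =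
      u ^ p * (Real.exp (-u * Real.cosh t) * Real.exp (p * t)) := by
    intro t
    have h0 : 0 < u * Real.exp t := by positivity
    have h1 : Real.exp (-(u * Real.exp t + u ^ 2 / (u * Real.exp t)) / 2) =
        Real.exp (-u * Real.cosh t) := by
      rw [Real.cosh_eq, Real.exp_neg]; congr 1; field_simp
    rw [h1, abs_of_pos h0, smul_eq_mul, Real.rpow_sub_one h0.ne', Real.mul_rpow hu.le
      (Real.exp_pos t).le, ← Real.exp_mul, mul_comm t p]
    field_simp
  have hint : Integrable fun t => Real.exp (-u * Real.cosh t) * Real.exp (p * t) := by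
    have h := integrableOn_besselInt p hu
    rw [← himg, integrableOn_image_iff_integrableOn_abs_deriv_smul MeasurableSet.univ hder hinj,
      integrableOn_univ] at h
    simp_rw [hfun] at h
    exact (integrable_const_mul_iff (isUnit_iff_ne_zero.2 (by positivity)) _).1 h
  have hneg : ∫ t in Iic (0 : ℝ), Real.exp (-u * Real.cosh t) * Real.exp (p * t) =
      ∫ t in Ioi (0 : ℝ), Real.exp (-u * Real.cosh t) * Real.exp (-(p * t)) := by
    simpa using (integral_comp_neg_Ioi (0 : ℝ)
      fun t => Real.exp (-u * Real.cosh t) * Real.exp (p * t)).symm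
  have hint' : Integrable fun t => Real.exp (-u * Real.cosh t) * Real.exp (-(p * t)) := by
    simpa using hint.comp_neg
  rw [besselInt, ← himg, integral_image_eq_integral_abs_deriv_smul MeasurableSet.univ hder hinj,
    Measure.restrict_univ]
  simp_rw [hfun]
  have hcosh : ∫ t : ℝ, Real.exp (-u * Real.cosh t) * Real.exp (p * t) = 2 * besselK p u := by
    rw [← intervalIntegral.integral_Iic_add_Ioi (b := 0) hint.integrableOn hint.integrableOn,
      hneg, ← integral_add hint'.integrableOn hint.integrableOn, besselK, ← integral_const_mul]
    refine setIntegral_congr_fun measurableSet_Ioi fun t _ => ?_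
    simp only [Real.cosh_eq (p * t)]
    ring
  rw [integral_const_mul, hcosh]
  ring

lemma besselK_neg (ν x : ℝ) : besselK (-ν) x = besselK ν x := by
  simp [besselK, neg_mul, Real.cosh_neg]

lemma besselInt_neg (p : ℝ) {u : ℝ} (hu : 0 < u) :
    besselInt (-p) u = u ^ (-2 * p) * besselInt p u := by
  rw [besselInt_eq_besselK _ hu, besselInt_eq_besselK _ hu, besselK_neg,
    show -2 * p = -p + -p by ring, Real.rpow_add hu, Real.rpow_neg hu.le]
  field_simp

/-! ### The antiderivative of `x ^ ν K_ν(x)` -/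

/-- The function `(x / 2) (K_ν L_{ν-1} + L_ν K_{ν-1})`, an antiderivative of a multiple of
`x ^ ν K_ν(x)`. -/
noncomputable def besselStruve (ν x : ℝ) : ℝ :=
  x / 2 * (besselK ν x * struveL (ν - 1) x + struveL ν x * besselK (ν - 1) x)

/-- Powers of `x` are distributed over the factors so that each one has a simple derivative. -/
lemma besselStruve_eq (ν : ℝ) {x : ℝ} (hx : 0 < x) :
    besselStruve ν x = 1 / 4 * (besselInt ν x * (x ^ (-(ν - 1)) * struveL (ν - 1) x) +
      x ^ ν * struveL ν x * besselInt (1 - ν) x) := by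
  have h1 : x ^ ν * x ^ (-(ν - 1)) = x := by rw [← Real.rpow_add hx]; simp
  rw [besselStruve, besselInt_eq_besselK _ hx, besselInt_eq_besselK _ hx,
    show 1 - ν = -(ν - 1) by ring, besselK_neg]
  linear_combination
    (-1 / 2 * (besselK ν x * struveL (ν - 1) x + struveL ν x * besselK (ν - 1) x)) * h1

lemma hasDerivAt_besselStruve {ν x : ℝ} (hν : -(1 / 2) < ν) (hx : 0 < x) :
    HasDerivAt (besselStruve ν)
      (2 ^ (-(ν + 1)) / (√Real.pi * Real.Gamma (ν + 1 / 2)) * besselInt ν x) x := by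
  have hev : besselStruve ν =ᶠ[𝓝 x] fun x =>
      1 / 4 * (besselInt ν x * (x ^ (-(ν - 1)) * struveL (ν - 1) x) +
        x ^ ν * struveL ν x * besselInt (1 - ν) x) := by
    filter_upwards [lt_mem_nhds hx] with y hy using besselStruve_eq ν hy
  have hL := hasDerivAt_rpow_neg_mul_struveL (ν := ν - 1) (by linarith) hx
  rw [sub_add_cancel, show ν - 1 + 3 / 2 = ν + 1 / 2 by ring] at hL
  refine ((((hasDerivAt_besselInt ν hx).mul hL).add ((hasDerivAt_rpow_mul_struveL hν hx).mul
    (hasDerivAt_besselInt (1 - ν) hx))).const_mul (1 / 4)).congr_of_eventuallyEq hev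
    |>.congr_deriv ?_
  have e1 : besselInt (ν - 1) x = x ^ (-2 * (1 - ν)) * besselInt (1 - ν) x := by
    rw [← besselInt_neg _ hx]; congr 1; ring
  have e2 : besselInt (1 - ν - 1) x = x ^ (-2 * ν) * besselInt ν x := by
    rw [← besselInt_neg _ hx]; congr 1; ring
  have e3 : (2 : ℝ) ^ (-(ν - 1)) = 4 * 2 ^ (-(ν + 1)) := by
    rw [show -(ν - 1) = -(ν + 1) + 2 by ring, Real.rpow_add two_pos]; norm_num; ring
  have e4 : x * x ^ (-2 * (1 - ν)) * x ^ (-(ν - 1)) = x ^ ν := by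
    nth_rw 1 [← Real.rpow_one x]
    rw [← Real.rpow_add hx, ← Real.rpow_add hx]; congr 1; ring
  have e5 : x * x ^ (-2 * ν) * x ^ ν = x ^ (-(ν - 1)) := by
    nth_rw 1 [← Real.rpow_one x]
    rw [← Real.rpow_add hx, ← Real.rpow_add hx]; congr 1; ring
  rw [e1, e2, e3]
  linear_combination -(1 / 4) * besselInt (1 - ν) x * struveL (ν - 1) x * e4
    - 1 / 4 * besselInt ν x * struveL ν x * e5

lemma tendsto_besselStruve_zero {ν : ℝ} (hν : 0 ≤ ν) :
    Tendsto (besselStruve ν) (𝓝[>] 0) (𝓝 0) := by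
  have hS : ∀ b : ℝ, 0 < b → Tendsto (fun x : ℝ => invGammaSeries (3 / 2) b ((x / 2) ^ 2))
      (𝓝[>] 0) (𝓝 (invGammaSeries (3 / 2) b ((0 / 2) ^ 2))) := fun b hb =>
    (hasDerivAt_invGammaSeries_sq (by norm_num) hb 0).continuousAt.tendsto.mono_left
      nhdsWithin_le_nhds
  have hpow : ∀ r : ℝ, 0 < r → Tendsto (fun x : ℝ => x ^ r) (𝓝[>] 0) (𝓝 0) := fun r hr => by
    have := (Real.continuousAt_rpow_const 0 r (Or.inr hr.le)).tendsto
    rw [Real.zero_rpow hr.ne'] at this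
    exact this.mono_left nhdsWithin_le_nhds
  have hpos : ∀ᶠ x : ℝ in 𝓝[>] 0, 0 < x := self_mem_nhdsWithin
  -- A function `O(x ^ (-2 q))` times an `O(x ^ r)`, where `2 q < r`.
  have hmul : ∀ p q r : ℝ, 0 ≤ q → 0 < p + q → 2 * q < r →
      Tendsto (fun x => besselInt p x * x ^ r) (𝓝[>] 0) (𝓝 0) := by
    intro p q r hq hpq hr
    obtain ⟨C, hC⟩ := exists_besselInt_le hq hpq
    have h := (hpow (r - 2 * q) (by linarith)).const_mul C
    rw [mul_zero] at h
    refine squeeze_zero' ?_ ?_ h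
    · filter_upwards [hpos] with x hx using
        mul_nonneg (besselInt_nonneg p x) (Real.rpow_nonneg hx.le r)
    · filter_upwards [hpos] with x hx
      calc besselInt p x * x ^ r ≤ C * x ^ (-2 * q) * x ^ r := by gcongr; exact hC x hx
        _ = C * x ^ (r - 2 * q) := by rw [mul_assoc, ← Real.rpow_add hx]; congr 2; ring
  have h1 := (hmul ν (1 / 4) 1 (by norm_num) (by linarith) (by norm_num)).mul
    (hS (ν + 1 / 2) (by linarith))
  have h2 := (hmul (1 - ν) ν (2 * ν + 1) hν (by linarith) (by linarith)).mul
    (hS (ν + 3 / 2) (by linarith))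
  have h := ((h1.const_mul (2 ^ (-(ν - 1)) / 2)).add
    (h2.const_mul (2 ^ ν * (1 / 2) ^ (2 * ν + 1)))).const_mul (1 / 4)
  simp only [zero_mul, mul_zero, add_zero] at h
  refine h.congr' ?_
  filter_upwards [hpos] with x hx
  rw [besselStruve_eq ν hx, rpow_neg_mul_struveL _ hx, rpow_mul_struveL _ hx, Real.rpow_one,
    show ν - 1 + 3 / 2 = ν + 1 / 2 by ring, show x / 2 = 1 / 2 * x by ring,
    Real.mul_rpow (by norm_num) hx.le]
  ring

/-- The antiderivative of `x ^ ν K_ν(x)`; its integrability at `0` comes with the formula. -/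
lemma integral_besselInt {ν x : ℝ} (hν : 0 ≤ ν) (hx : 0 ≤ x) :
    IntegrableOn (fun u => 2 ^ (-(ν + 1)) / (√Real.pi * Real.Gamma (ν + 1 / 2)) * besselInt ν u)
      (Ioc 0 x) ∧
    ∫ u in Ioc 0 x, 2 ^ (-(ν + 1)) / (√Real.pi * Real.Gamma (ν + 1 / 2)) * besselInt ν u =
      besselStruve ν x := by
  have h0 : besselStruve ν 0 = 0 := by simp [besselStruve]
  have hder : ∀ u ∈ Ioo 0 x, HasDerivAt (besselStruve ν)
      (2 ^ (-(ν + 1)) / (√Real.pi * Real.Gamma (ν + 1 / 2)) * besselInt ν u) u :=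
    fun u hu => hasDerivAt_besselStruve (by linarith) hu.1
  have hcont : ContinuousOn (besselStruve ν) (Icc 0 x) := by
    intro u hu
    rcases hu.1.eq_or_lt with rfl | hu0
    · refine ContinuousWithinAt.mono ?_ Icc_subset_Ici_self
      rw [← continuousWithinAt_Ioi_iff_Ici, ContinuousWithinAt, h0]
      exact tendsto_besselStruve_zero hν
    · exact (hasDerivAt_besselStruve (by linarith) hu0).continuousAt.continuousWithinAt
  have hint := intervalIntegral.integrableOn_deriv_of_nonneg hcont hder fun u _ =>
    mul_nonneg (div_nonneg (by positivity) (mul_nonneg (Real.sqrt_nonneg _)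
      (Real.Gamma_pos_of_pos (by linarith)).le)) (besselInt_nonneg ν u)
  refine ⟨hint, ?_⟩
  rw [← intervalIntegral.integral_of_le hx, intervalIntegral.integral_eq_sub_of_hasDerivAt_of_le hx
    hcont hder ((intervalIntegrable_iff_integrableOn_Ioc_of_le hx).2 hint), h0, sub_zero]

/-! ### Normal variables with a Gamma-distributed variance -/

lemma charFun_map_mul_gaussianReal (m : Measure ℝ) [IsProbabilityMeasure m] {f : ℝ → ℝ}
    (hf : Measurable f) (v : ℝ≥0) (t : ℝ) :
    charFun ((m.prod (gaussianReal 0 v)).map fun p => f p.1 * p.2) t =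
      ((∫ w, Real.exp (-(v * t ^ 2 * f w ^ 2 / 2)) ∂m : ℝ) : ℂ) := by
  have hmeas : Measurable fun p : ℝ × ℝ => f p.1 * p.2 := by fun_prop
  rw [charFun_apply_real, integral_map hmeas.aemeasurable (by fun_prop), integral_prod,
    ← integral_complex_ofReal]
  · refine integral_congr_ae (Eventually.of_forall fun w => ?_)
    have h := charFun_gaussianReal (μ := 0) (v := v) (t * f w)
    rw [charFun_apply_real] at h
    simp only
    convert h using 1
    · refine integral_congr_ae (Eventually.of_forall fun y => ?_)
      simp only
      push_cast
      ring_nf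
    · push_cast
      ring_nf
  · refine Integrable.of_bound (C := 1) (by fun_prop) (Eventually.of_forall fun p => ?_)
    rw [← Complex.ofReal_mul, Complex.norm_exp_ofReal_mul_I]

lemma integral_exp_neg_sq_gaussianReal {v : ℝ≥0} (hv : v ≠ 0) {c : ℝ} (hc : 0 ≤ c) :
    ∫ x, Real.exp (-(c * x ^ 2 / 2)) ∂(gaussianReal 0 v) = (1 + c * v) ^ (-(1 / 2) : ℝ) := by
  have hv' : (0 : ℝ) < v := by positivity
  have h : ∀ x : ℝ, gaussianPDFReal 0 v x • Real.exp (-(c * x ^ 2 / 2)) =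
      (√(2 * Real.pi * v))⁻¹ * Real.exp (-((1 + c * v) / (2 * v)) * x ^ 2) := by
    intro x
    rw [gaussianPDFReal, smul_eq_mul, mul_assoc, ← Real.exp_add]
    congr 2
    field_simp
    ring
  rw [integral_gaussianReal_eq_integral_smul hv]
  simp_rw [h]
  rw [integral_const_mul, integral_gaussian, ← Real.sqrt_inv, ← Real.sqrt_mul (by positivity),
    Real.rpow_neg (by positivity), ← Real.sqrt_eq_rpow, ← Real.sqrt_inv]
  congr 1
  field_simp

lemma measurable_gammaPDF (a r : ℝ) : Measurable (gammaPDF a r) :=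
  (measurable_gammaPDFReal a r).ennreal_ofReal

lemma integral_exp_neg_gammaMeasure {a r c : ℝ} (ha : 0 < a) (hr : 0 < r) (hc : 0 ≤ c) :
    ∫ x, Real.exp (-(c * x)) ∂(gammaMeasure a r) = (r / (r + c)) ^ a := by
  have h0 : ∀ x, 0 ≤ gammaPDFReal a r x := gammaPDFReal_nonneg ha hr
  rw [gammaMeasure, integral_withDensity_eq_integral_toReal_smul
    (measurable_gammaPDF a r)
    (Eventually.of_forall fun _ => ENNReal.ofReal_lt_top)]
  have h : ∀ x : ℝ, (gammaPDF a r x).toReal • Real.exp (-(c * x)) =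
      (Ici 0).indicator (fun x => r ^ a / Real.Gamma a *
        (x ^ (a - 1) * Real.exp (-((r + c) * x)))) x := by
    intro x
    rw [gammaPDF, ENNReal.toReal_ofReal (h0 x), gammaPDFReal, indicator_apply]
    simp only [mem_Ici]
    split_ifs
    · rw [smul_eq_mul, mul_assoc, mul_assoc, ← Real.exp_add]
      ring_nf
    · simp
  simp_rw [h]
  have hG := Real.Gamma_pos_of_pos ha
  rw [integral_indicator measurableSet_Ici, integral_Ici_eq_integral_Ioi, integral_const_mul,
    Real.integral_rpow_mul_exp_neg_mul_Ioi ha (by positivity), Real.div_rpow hr.le (by positivity),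
    Real.div_rpow zero_le_one (by positivity), Real.one_rpow]
  field_simp

/-- The law of `√W N`, where `W` has the Gamma distribution of shape `a` and rate `1 / 2`, and `N`
is an independent standard normal variable: a normal variable with random variance `W`. -/
noncomputable def gaussianGammaMixture (a : ℝ) : Measure ℝ :=
  ((gammaMeasure a (1 / 2)).prod (gaussianReal 0 1)).map fun p => √p.1 * p.2

lemma isProbabilityMeasure_gaussianGammaMixture {a : ℝ} (ha : 0 < a) :
    IsProbabilityMeasure (gaussianGammaMixture a) := by
  have := isProbabilityMeasure_gammaMeasure ha (one_half_pos (α := ℝ))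
  exact Measure.isProbabilityMeasure_map (by fun_prop)

lemma ae_nonneg_gammaMeasure (a r : ℝ) : ∀ᵐ w ∂gammaMeasure a r, 0 ≤ w := by
  rw [gammaMeasure, ae_withDensity_iff (measurable_gammaPDF a r)]
  exact Eventually.of_forall fun w hw => not_lt.1 fun h => hw (gammaPDF_of_neg h)

lemma charFun_gaussianGammaMixture {a : ℝ} (ha : 0 < a) (t : ℝ) :
    charFun (gaussianGammaMixture a) t = (((1 + t ^ 2) ^ (-a) : ℝ) : ℂ) := by
  have := isProbabilityMeasure_gammaMeasure ha (one_half_pos (α := ℝ))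
  rw [gaussianGammaMixture, charFun_map_mul_gaussianReal _ (by fun_prop)]
  congr 1
  have h : ∫ w, Real.exp (-(((1 : ℝ≥0) : ℝ) * t ^ 2 * √w ^ 2 / 2)) ∂(gammaMeasure a (1 / 2)) =
      ∫ w, Real.exp (-(t ^ 2 / 2 * w)) ∂(gammaMeasure a (1 / 2)) := by
    refine integral_congr_ae ?_
    filter_upwards [ae_nonneg_gammaMeasure a (1 / 2)] with w hw
    rw [Real.sq_sqrt hw]
    congr 1
    push_cast
    ring
  rw [h, integral_exp_neg_gammaMeasure ha (by norm_num) (by positivity), Real.rpow_neg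
    (by positivity), ← Real.inv_rpow (by positivity)]
  congr 1
  field_simp

/-- The Bessel density `∫ γ(w) φ(u / √w) / √w dw` of the mixture. -/
lemma lintegral_gammaPDF_mul_gaussianPDF {a u : ℝ} (ha : 0 < a) (hu : 0 < u) :
    ∫⁻ w, gammaPDF a (1 / 2) w * gaussianPDF 0 w.toNNReal u =
      ENNReal.ofReal (2 ^ (-(a + 1 / 2)) / (√Real.pi * Real.Gamma a) *
        besselInt (a - 1 / 2) u) := by
  have hG := Real.Gamma_pos_of_pos ha
  have hC : 0 ≤ 2 ^ (-(a + 1 / 2)) / (√Real.pi * Real.Gamma a) := by positivity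
  have h : ∀ w ∈ Ioi (0 : ℝ), gammaPDF a (1 / 2) w * gaussianPDF 0 w.toNNReal u =
      ENNReal.ofReal (2 ^ (-(a + 1 / 2)) / (√Real.pi * Real.Gamma a) *
        (w ^ (a - 1 / 2 - 1) * Real.exp (-(w + u ^ 2 / w) / 2))) := by
    intro w hw
    rw [mem_Ioi] at hw
    rw [gammaPDF_of_nonneg hw.le, gaussianPDF, ← ENNReal.ofReal_mul (by positivity),
      gaussianPDFReal, Real.coe_toNNReal _ hw.le]
    congr 1
    have e1 : Real.exp (-(w + u ^ 2 / w) / 2) =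
        Real.exp (-(1 / 2 * w)) * Real.exp (-(u - 0) ^ 2 / (2 * w)) := by
      rw [← Real.exp_add]; congr 1; field_simp; ring
    have e2 : w ^ (a - 1 / 2 - 1) = w ^ (a - 1) * (√w)⁻¹ := by
      rw [Real.sqrt_eq_rpow, ← Real.rpow_neg hw.le, ← Real.rpow_add hw]; congr 1; ring
    have e3 : (2 : ℝ) ^ (-(a + 1 / 2)) = (1 / 2) ^ a * (√2)⁻¹ := by
      rw [Real.sqrt_eq_rpow, ← Real.rpow_neg zero_le_two, one_div, Real.inv_rpow zero_le_two,
        ← Real.rpow_neg zero_le_two, ← Real.rpow_add two_pos]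
      congr 1; ring
    rw [e1, e2, e3, Real.sqrt_mul (by positivity), Real.sqrt_mul (by positivity)]
    field_simp
  have hneg : ∀ w ∈ Iic (0 : ℝ), gammaPDF a (1 / 2) w * gaussianPDF 0 w.toNNReal u = 0 := by
    intro w hw
    rw [Real.toNNReal_of_nonpos hw, gaussianPDF_zero_var, Pi.zero_apply, mul_zero]
  rw [← lintegral_add_compl _ (measurableSet_Ioi (a := (0 : ℝ))), compl_Ioi,
    setLIntegral_congr_fun measurableSet_Iic hneg, lintegral_zero, add_zero,
    setLIntegral_congr_fun measurableSet_Ioi h,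
    ← ofReal_integral_eq_lintegral_ofReal ((integrableOn_besselInt _ hu).const_mul _),
    integral_const_mul, besselInt]
  filter_upwards [ae_restrict_mem measurableSet_Ioi] with w hw
  rw [mem_Ioi] at hw
  exact mul_nonneg hC (by positivity)

lemma gaussianGammaMixture_apply {a : ℝ} (ha : 0 < a) {B : Set ℝ} (hB : MeasurableSet B) :
    gaussianGammaMixture a B =
      ∫⁻ u in B, ∫⁻ w, gammaPDF a (1 / 2) w * gaussianPDF 0 w.toNNReal u := by
  have := isProbabilityMeasure_gammaMeasure ha (one_half_pos (α := ℝ))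
  have hmeas : Measurable fun p : ℝ × ℝ => √p.1 * p.2 := by fun_prop
  have hγ := measurable_gammaPDF a (1 / 2)
  have hg : Measurable fun p : ℝ × ℝ => gaussianPDF 0 p.1.toNNReal p.2 :=
    measurable_uncurry_gaussianPDF.comp
      (measurable_const.prodMk (measurable_fst.real_toNNReal.prodMk measurable_snd))
  have hfib : ∀ᵐ w ∂gammaMeasure a (1 / 2),
      gaussianReal 0 1 (Prod.mk w ⁻¹' ((fun p : ℝ × ℝ => √p.1 * p.2) ⁻¹' B)) =
        ∫⁻ u in B, gaussianPDF 0 w.toNNReal u := by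
    have h0 : ∀ᵐ w ∂gammaMeasure a (1 / 2), w ≠ 0 :=
      (withDensity_absolutelyContinuous _ _).ae_le (Measure.ae_ne volume 0)
    filter_upwards [ae_nonneg_gammaMeasure a (1 / 2), h0] with w hw hw0
    have hw' : 0 < w := lt_of_le_of_ne hw hw0.symm
    have hv : w.toNNReal ≠ 0 := by simpa using hw'
    have hmap := gaussianReal_map_const_mul (μ := 0) (v := 1) √w
    rw [mul_zero, mul_one] at hmap
    have hvar : NNReal.mk (√w ^ 2) (sq_nonneg _) = w.toNNReal := by
      ext
      simp [Real.sq_sqrt hw, hw]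
    rw [hvar] at hmap
    rw [← gaussianReal_apply 0 hv, ← hmap, Measure.map_apply (by fun_prop) hB]
    rfl
  rw [gaussianGammaMixture, Measure.map_apply hmeas hB, Measure.prod_apply (hmeas hB),
    lintegral_congr_ae hfib, gammaMeasure, lintegral_withDensity_eq_lintegral_mul _ hγ
      (Measurable.lintegral_prod_right' hg), lintegral_lintegral_swap]
  · refine lintegral_congr fun w => ?_
    rw [Pi.mul_apply, lintegral_const_mul _ (by fun_prop)]
  · exact ((hγ.comp measurable_snd).mul (hg.comp measurable_swap)).aemeasurable

lemma gaussianGammaMixture_absolutelyContinuous {a : ℝ} (ha : 0 < a) :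
    gaussianGammaMixture a ≪ volume :=
  Measure.AbsolutelyContinuous.mk fun B hB h0 => by
    rw [gaussianGammaMixture_apply ha hB, setLIntegral_measure_zero _ _ h0]

lemma gaussianGammaMixture_map_neg {a : ℝ} (ha : 0 < a) :
    (gaussianGammaMixture a).map (fun x => -x) = gaussianGammaMixture a := by
  have := isProbabilityMeasure_gaussianGammaMixture ha
  refine Measure.ext_of_charFun (funext fun t => ?_)
  have h := charFun_map_mul (μ := gaussianGammaMixture a) (-1) t
  simp only [neg_one_mul] at h
  rw [h, charFun_gaussianGammaMixture ha, charFun_gaussianGammaMixture ha, neg_sq]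

lemma gaussianGammaMixture_real_Ici {a : ℝ} (ha : 0 < a) (x : ℝ) :
    (gaussianGammaMixture a).real (Ici x) = (gaussianGammaMixture a).real (Iic (-x)) := by
  nth_rw 1 [← gaussianGammaMixture_map_neg ha]
  rw [map_measureReal_apply (by fun_prop) measurableSet_Ici]
  congr 1
  ext y
  simp

lemma gaussianGammaMixture_real_Iic_add_Iic_neg {a : ℝ} (ha : 0 < a) (x : ℝ) :
    (gaussianGammaMixture a).real (Iic x) + (gaussianGammaMixture a).real (Iic (-x)) = 1 := by
  have := isProbabilityMeasure_gaussianGammaMixture ha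
  have hx : gaussianGammaMixture a {x} = 0 :=
    gaussianGammaMixture_absolutelyContinuous ha (measure_singleton x)
  have h : (gaussianGammaMixture a).real (Ici x) = (gaussianGammaMixture a).real (Ioi x) := by
    refine measureReal_congr ?_
    rw [← Ioi_union_left]
    exact union_ae_eq_left_of_ae_eq_empty (ae_eq_empty.2 hx)
  rw [← gaussianGammaMixture_real_Ici ha, h, ← compl_Iic, probReal_compl_eq_one_sub
    measurableSet_Iic, add_sub_cancel]

lemma gaussianGammaMixture_real_Ioc {ν x : ℝ} (hν : 0 ≤ ν) (hx : 0 ≤ x) :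
    (gaussianGammaMixture (ν + 1 / 2)).real (Ioc 0 x) = besselStruve ν x := by
  obtain ⟨hint, hval⟩ := integral_besselInt hν hx
  have ha : 0 < ν + 1 / 2 := by linarith
  have hC : 0 ≤ 2 ^ (-(ν + 1)) / (√Real.pi * Real.Gamma (ν + 1 / 2)) :=
    div_nonneg (by positivity) (mul_nonneg (Real.sqrt_nonneg _) (Real.Gamma_pos_of_pos ha).le)
  have hnn : ∀ u, 0 ≤ 2 ^ (-(ν + 1)) / (√Real.pi * Real.Gamma (ν + 1 / 2)) * besselInt ν u :=
    fun u => mul_nonneg hC (besselInt_nonneg ν u)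
  have hdens : ∀ u ∈ Ioc 0 x,
      ∫⁻ w, gammaPDF (ν + 1 / 2) (1 / 2) w * gaussianPDF 0 w.toNNReal u =
        ENNReal.ofReal (2 ^ (-(ν + 1)) / (√Real.pi * Real.Gamma (ν + 1 / 2)) * besselInt ν u) := by
    intro u hu
    rw [lintegral_gammaPDF_mul_gaussianPDF ha hu.1, add_sub_cancel_right,
      show ν + 1 / 2 + 1 / 2 = ν + 1 by ring]
  rw [measureReal_def, gaussianGammaMixture_apply ha measurableSet_Ioc,
    setLIntegral_congr_fun measurableSet_Ioc hdens,
    ← ofReal_integral_eq_lintegral_ofReal hint (Eventually.of_forall hnn),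
    ENNReal.toReal_ofReal (integral_nonneg hnn), hval]

lemma gaussianGammaMixture_real_Iic_of_nonneg {ν x : ℝ} (hν : 0 ≤ ν) (hx : 0 ≤ x) :
    (gaussianGammaMixture (ν + 1 / 2)).real (Iic x) = 1 / 2 + besselStruve ν x := by
  have ha : 0 < ν + 1 / 2 := by linarith
  have := isProbabilityMeasure_gaussianGammaMixture ha
  have h0 := gaussianGammaMixture_real_Iic_add_Iic_neg ha 0
  rw [neg_zero] at h0
  rw [← Iic_union_Ioc_eq_Iic hx, measureReal_union (Iic_disjoint_Ioc le_rfl) measurableSet_Ioc,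
    gaussianGammaMixture_real_Ioc hν hx]
  linarith

lemma gaussianGammaMixture_real_Iic {ν : ℝ} (hν : 0 ≤ ν) (x : ℝ) :
    (gaussianGammaMixture (ν + 1 / 2)).real (Iic x) =
      1 / 2 + x / 2 * (besselK ν |x| * struveL (ν - 1) |x| +
        struveL ν |x| * besselK (ν - 1) |x|) := by
  rcases le_total 0 x with hx | hx
  · rw [gaussianGammaMixture_real_Iic_of_nonneg hν hx, besselStruve, abs_of_nonneg hx]
  · have h := gaussianGammaMixture_real_Iic_add_Iic_neg (by linarith : 0 < ν + 1 / 2) x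
    rw [gaussianGammaMixture_real_Iic_of_nonneg hν (neg_nonneg.2 hx), besselStruve] at h
    rw [abs_of_nonpos hx]
    linear_combination h

/-! ### The law of the sample mean -/

lemma charFun_map_mul_of_isCenteredBivariateNormal {Ω : Type*} [MeasurableSpace Ω]
    {P : Measure Ω} [IsProbabilityMeasure P] {σX σY : ℝ} (hσX : 0 < σX) (hσY : 0 < σY)
    {X Y : Ω → ℝ} (hXY : IsCenteredBivariateNormal P X Y σX σY 0) (t : ℝ) :
    charFun (P.map fun ω => X ω * Y ω) t =
      (((1 + (t * (σX * σY)) ^ 2) ^ (-(1 / 2) : ℝ) : ℝ) : ℂ) := by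
  have hcov : covariance X Y P = 0 := by
    have h := hXY.correlation
    rwa [div_eq_zero_iff, or_iff_left (mul_pos hσX hσY).ne'] at h
  have hX := hXY.gaussian.fst
  have hY := hXY.gaussian.snd
  have hind := hXY.gaussian.indepFun_of_covariance_eq_zero hcov
  have hXl : P.map X = gaussianReal 0 (σX ^ 2).toNNReal := by
    rw [hX.map_eq_gaussianReal, hXY.mean_fst, hXY.variance_fst]
  have hYl : P.map Y = gaussianReal 0 (σY ^ 2).toNNReal := by
    rw [hY.map_eq_gaussianReal, hXY.mean_snd, hXY.variance_snd]
  have hjoint := (indepFun_iff_map_prod_eq_prod_map_map hX.aemeasurable hY.aemeasurable).1 hind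
  have hmap : P.map (fun ω => X ω * Y ω) = ((gaussianReal 0 (σX ^ 2).toNNReal).prod
      (gaussianReal 0 (σY ^ 2).toNNReal)).map fun p => id p.1 * p.2 := by
    rw [← hXl, ← hYl, ← hjoint, AEMeasurable.map_map_of_aemeasurable (by fun_prop)
      hXY.gaussian.aemeasurable]
    rfl
  have hv : (σX ^ 2).toNNReal ≠ 0 := by simpa using hσX.ne'
  rw [hmap, charFun_map_mul_gaussianReal _ measurable_id]
  simp only [id]
  rw [integral_exp_neg_sq_gaussianReal hv (by positivity), Real.coe_toNNReal _ (sq_nonneg _),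
    Real.coe_toNNReal _ (sq_nonneg _)]
  ring_nf

/-- Both laws have the characteristic function `(1 + t ^ 2) ^ (-n / 2)`. -/
lemma map_sampleMean_eq_gaussianGammaMixture {Ω Ω' : Type*} [MeasurableSpace Ω]
    [MeasurableSpace Ω'] {P : Measure Ω} [IsProbabilityMeasure P] {Q : Measure Ω'}
    [IsProbabilityMeasure Q] {σX σY : ℝ} (hσX : 0 < σX) (hσY : 0 < σY) {X Y : Ω → ℝ}
    (hXY : IsCenteredBivariateNormal P X Y σX σY 0) {n : ℕ} (hn : 1 ≤ n) {Z : Fin n → Ω' → ℝ}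
    (hZ_indep : iIndepFun Z Q) (hZ_law : ∀ i, IdentDistrib (Z i) (fun ω => X ω * Y ω) Q P) :
    Q.map (fun ω => (σX * σY / n)⁻¹ * sampleMean Z ω) = gaussianGammaMixture (n / 2) := by
  have hn0 : (0 : ℝ) < n := by exact_mod_cast hn
  have hZm : ∀ i, AEMeasurable (Z i) Q := fun i => (hZ_law i).aemeasurable_fst
  have hsum : AEMeasurable (fun ω => ∑ i, Z i ω) Q := by fun_prop
  have hfun : (fun ω => (σX * σY / n)⁻¹ * sampleMean Z ω) =
      fun ω => (σX * σY)⁻¹ * ∑ i, Z i ω := by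
    funext ω
    rw [sampleMean, ← mul_assoc]
    congr 1
    field_simp
  have := isProbabilityMeasure_gaussianGammaMixture (half_pos hn0)
  have : IsProbabilityMeasure (Q.map fun ω => (σX * σY)⁻¹ * ∑ i, Z i ω) :=
    Measure.isProbabilityMeasure_map (by fun_prop)
  rw [hfun]
  refine Measure.ext_of_charFun (funext fun t => ?_)
  have hone : (σX * σY)⁻¹ * t * (σX * σY) = t := by field_simp
  rw [charFun_map_mul_comp hsum, hZ_indep.charFun_map_fun_sum_eq_prod hZm, Finset.prod_apply]
  simp_rw [(hZ_law _).map_eq, charFun_map_mul_of_isCenteredBivariateNormal hσX hσY hXY, hone]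
  rw [Finset.prod_const, Finset.card_univ, Fintype.card_fin,
    charFun_gaussianGammaMixture (half_pos hn0), ← Complex.ofReal_pow, ← Real.rpow_natCast,
    ← Real.rpow_mul (by positivity)]
  congr 2
  ring

end

theorem mainTheorem8
    {Ω Ω' : Type*} [MeasurableSpace Ω] [MeasurableSpace Ω']
    (P : Measure Ω) [IsProbabilityMeasure P] (Q : Measure Ω') [IsProbabilityMeasure Q]
    (σX σY : ℝ) (hσX : 0 < σX) (hσY : 0 < σY)
    (X Y : Ω → ℝ) (hXY : IsCenteredBivariateNormal P X Y σX σY 0)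
    (n : ℕ) (hn : 1 ≤ n)
    (Z : Fin n → Ω' → ℝ) (hZ_indep : iIndepFun Z Q)
    (hZ_law : ∀ i, IdentDistrib (Z i) (fun ω => X ω * Y ω) Q P)
    (s : ℝ) (hs : s = σX * σY / n) (x : ℝ) :
    Q.real {ω | sampleMean Z ω ≤ x} =
      1 / 2 + x / (2 * s) *
        (besselK (((n : ℝ) - 1) / 2) (|x| / s) * struveL (((n : ℝ) - 3) / 2) (|x| / s) +
          struveL (((n : ℝ) - 1) / 2) (|x| / s) * besselK (((n : ℝ) - 3) / 2) (|x| / s)) := by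
  have hn0 : (1 : ℝ) ≤ n := by exact_mod_cast hn
  have hs0 : 0 < s := by rw [hs]; positivity
  have hZm : ∀ i, AEMeasurable (Z i) Q := fun i => (hZ_law i).aemeasurable_fst
  have hmean : AEMeasurable (fun ω => s⁻¹ * sampleMean Z ω) Q := by
    unfold sampleMean
    fun_prop
  have hset : {ω | sampleMean Z ω ≤ x} =
      (fun ω => s⁻¹ * sampleMean Z ω) ⁻¹' Set.Iic (x / s) := by
    ext ω
    rw [Set.mem_ofPred_eq, Set.mem_preimage, Set.mem_Iic, inv_mul_eq_div,
      div_le_div_iff_of_pos_right hs0]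
  have hlaw := map_sampleMean_eq_gaussianGammaMixture hσX hσY hXY hn hZ_indep hZ_law
  rw [← hs, show (n : ℝ) / 2 = ((n : ℝ) - 1) / 2 + 1 / 2 by ring] at hlaw
  rw [hset, ← map_measureReal_apply_of_aemeasurable hmean measurableSet_Iic, hlaw,
    gaussianGammaMixture_real_Iic (by linarith), abs_div, abs_of_pos hs0, div_div, mul_comm s 2,
    show ((n : ℝ) - 1) / 2 - 1 = ((n : ℝ) - 3) / 2 by ring]
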